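/- **Conventions.** For families $\mathcal A,\mathcal B$ of sets, $S_1(\mathcal A,\mathcal B)$ says: for all $\mathcal U_1,\mathcal U_2,\dots\in\mathcal A$ there are $U_n\in\mathcal U_n$ with $\{U_n:n\in\mathbb N\}\in\mathcal B$; $S_{\mathrm{fin}}(\mathcal A,\mathcal B)$ says: for all $\mathcal U_1,\mathcal U_2,\dots\in\mathcal A$ there are finite $\mathcal F_n\subseteq\mathcal U_n$ with $\bigcup_n\mathcal F_n\in\mathcal B$. For a topological space $Y$, $\mathrm D$ is the set of all families of subsets of $Y$ whose union is dense in $Y$, $\mathrm D_{\mathrm o}$ is the set of those members of $\mathrm D$ that consist of open sets, and $\mathrm O$ is the set of all open covers of $Y$. For a point $x$ of a space $Z$, $\pi\mathrm N_{\mathrm{fin}}(x)$ is the set of all families $\mathcal N$ of finite subsets of $Z$ such that every open neighbourhood of $x$ contains a member of $\mathcal N$; $Z$ satisfies $S(\pi\mathrm N_{\mathrm{fin}},\pi\mathrm N_{\mathrm{fin}})$ if $S(\pi\mathrm N_{\mathrm{fin}}(x),\pi\mathrm N_{\mathrm{fin}}(x))$ holds for every $x\in Z$ ($S\in\{S_1,S_{\mathrm{fin}}\}$).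 The Pixley–Roy space $\mathrm{PR}(X)$ is the set of all nonempty finite subsets of $X$, with the topology whose basic open sets are $[F,U]=\{H\in\mathrm{PR}(X):F\subseteq H\subseteq U\}$, for $F\in\mathrm{PR}(X)$ and $U\subseteq X$ open. A space is $R_1$ if any two points either have the same neighbourhoods or have disjoint neighbourhoods (for example, every Hausdorff space and every regular space is $R_1$). **Theorem.** Let $X$ be a nonempty countable topological space. 1. If all finite powers of $X$ satisfy $S_1(\pi\mathrm N_{\mathrm{fin}},\pi\mathrm N_{\mathrm{fin}})$, then $\mathrm{PR}(X)$ satisfies all eight properties $S_{\mathrm{fin}}(\mathrm D,\mathrm D)$, $S_{\mathrm{fin}}(\mathrm D_{\mathrm o},\mathrm D)$, $S_{\mathrm{fin}}(\mathrm O,\mathrm D)$, $S_{\mathrm{fin}}(\mathrm O,\mathrm O)$, $S_1(\mathrm D,\mathrm D)$, $S_1(\mathrm D_{\mathrm o},\mathrm D)$, $S_1(\mathrm O,\mathrm D)$, $S_1(\mathrm O,\mathrm O)$. 2. If some finite power of $X$ does not satisfy $S_1(\pi\mathrm N_{\mathrm{fin}},\pi\mathrm N_{\mathrm{fin}})$,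 but all finite powers of $X$ satisfy $S_{\mathrm{fin}}(\pi\mathrm N_{\mathrm{fin}},\pi\mathrm N_{\mathrm{fin}})$, then $\mathrm{PR}(X)$ satisfies $S_{\mathrm{fin}}(\mathrm D,\mathrm D)$, $S_{\mathrm{fin}}(\mathrm D_{\mathrm o},\mathrm D)$, $S_{\mathrm{fin}}(\mathrm O,\mathrm D)$, $S_{\mathrm{fin}}(\mathrm O,\mathrm O)$, $S_1(\mathrm O,\mathrm D)$ and $S_1(\mathrm O,\mathrm O)$; and, if $X$ is $R_1$ (in particular, if $X$ is Hausdorff), it satisfies neither $S_1(\mathrm D,\mathrm D)$ nor $S_1(\mathrm D_{\mathrm o},\mathrm D)$. 3. If some finite power of $X$ does not satisfy $S_{\mathrm{fin}}(\pi\mathrm N_{\mathrm{fin}},\pi\mathrm N_{\mathrm{fin}})$, then $\mathrm{PR}(X)$ satisfies $S_{\mathrm{fin}}(\mathrm O,\mathrm D)$, $S_{\mathrm{fin}}(\mathrm O,\mathrm O)$, $S_1(\mathrm O,\mathrm D)$ and $S_1(\mathrm O,\mathrm O)$; and, if $X$ is $R_1$ (in particular, if $X$ is Hausdorff), it satisfies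 none of $S_{\mathrm{fin}}(\mathrm D,\mathrm D)$, $S_{\mathrm{fin}}(\mathrm D_{\mathrm o},\mathrm D)$, $S_1(\mathrm D,\mathrm D)$, $S_1(\mathrm D_{\mathrm o},\mathrm D)$. -/

import Mathlib

namespace DenseSelection

/-- The selection principle `S₁(𝒜, ℬ)`: from every sequence `𝒰₀, 𝒰₁, …` of members of `𝒜` one can
choose `Uₙ ∈ 𝒰ₙ` such that `{Uₙ : n ∈ ℕ} ∈ ℬ`. -/
def SOne {α : Type*} (𝒜 ℬ : Set (Set α)) : Prop :=
  ∀ 𝒰 : ℕ → Set α, (∀ n, 𝒰 n ∈ 𝒜) →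
    ∃ V : ℕ → α, (∀ n, V n ∈ 𝒰 n) ∧ Set.range V ∈ ℬ

/-- The selection principle `S_fin(𝒜, ℬ)`: from every sequence `𝒰₀, 𝒰₁, …` of members of `𝒜` one
can choose finite `ℱₙ ⊆ 𝒰ₙ` such that `⋃ₙ ℱₙ ∈ ℬ`. -/
def SFin {α : Type*} (𝒜 ℬ : Set (Set α)) : Prop :=
  ∀ 𝒰 : ℕ → Set α, (∀ n, 𝒰 n ∈ 𝒜) →
    ∃ ℱ : ℕ → Set α, (∀ n, ℱ n ⊆ 𝒰 n ∧ (ℱ n).Finite) ∧ (⋃ n, ℱ n) ∈ ℬ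

/-- `D`: the families of subsets of `Y` whose union is dense in `Y`. -/
def DenseFamilies (Y : Type*) [TopologicalSpace Y] : Set (Set (Set Y)) :=
  {𝒰 | Dense (⋃₀ 𝒰)}

/-- `D_o`: the dense families all of whose members are open. -/
def OpenDenseFamilies (Y : Type*) [TopologicalSpace Y] : Set (Set (Set Y)) :=
  {𝒰 | Dense (⋃₀ 𝒰) ∧ ∀ U ∈ 𝒰, IsOpen U}

/-- `O`: the open covers of `Y`. -/
def OpenCovers (Y : Type*) [TopologicalSpace Y] : Set (Set (Set Y)) :=
  {𝒰 | ⋃₀ 𝒰 = Set.univ ∧ ∀ U ∈ 𝒰, IsOpen U}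

/-- `πN_fin(x)`: the `π`-networks of the point `x` consisting of finite sets. -/
def PiNetFin {X : Type*} [TopologicalSpace X] (x : X) : Set (Set (Set X)) :=
  {𝒩 | (∀ A ∈ 𝒩, A.Finite) ∧ ∀ U : Set X, IsOpen U → x ∈ U → ∃ A ∈ 𝒩, A ⊆ U}

/-- `X` satisfies `S₁(πN_fin, πN_fin)`. -/
def SOnePiNetFin (X : Type*) [TopologicalSpace X] : Prop :=
  ∀ x : X, SOne (PiNetFin x) (PiNetFin x)

/-- `X` satisfies `S_fin(πN_fin, πN_fin)`. -/
def SFinPiNetFin (X : Type*) [TopologicalSpace X] : Prop :=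
  ∀ x : X, SFin (PiNetFin x) (PiNetFin x)

/-- The points of the Pixley–Roy space: the nonempty finite subsets of `X`. -/
def PixleyRoy (X : Type*) : Type _ := {F : Finset X // F.Nonempty}

/-- The basic open set `[F, U] = {H : F ⊆ H ⊆ U}`. -/
def PixleyRoy.basic {X : Type*} (F : PixleyRoy X) (U : Set X) : Set (PixleyRoy X) :=
  {H | F.1 ⊆ H.1 ∧ (H.1 : Set X) ⊆ U}

/-- The Pixley–Roy topology, generated by the sets `[F, U]` with `U` open. -/
instance PixleyRoy.instTopologicalSpace {X : Type*} [TopologicalSpace X] :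
    TopologicalSpace (PixleyRoy X) :=
  TopologicalSpace.generateFrom
    {S | ∃ (F : PixleyRoy X) (U : Set X), IsOpen U ∧ S = PixleyRoy.basic F U}

end DenseSelection

open DenseSelection

/-!
For countable `Y`, the principle `S₁(O, O)` only asks to cover the points of `Y` one at a time; this
settles all the principles about open covers. The rest is a translation between dense families of
the Pixley–Roy space and `π`-networks of finite sets in the powers of `X`.

*From networks to density.* Let `F = {x₁, …, xₖ}` and let `𝒰` be a family with dense union. The
finite boxes `H₁ × ⋯ × Hₖ` with `xᵢ ∈ Hᵢ` and `⋃ Hᵢ ∈ ⋃ 𝒰` form a `π`-network at `x`: a point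
`H ⊆ U₁ ∪ ⋯ ∪ Uₖ` of `⋃ 𝒰` is split into the pieces `H ∩ Uᵢ`. Conversely, if a box lies in `Uᵏ`, then
`⋃ Hᵢ ∈ [F, U]`. So a selection of boxes that is a `π`-network at `x` gives a selection from `𝒰`
whose union has `F` in its closure (`denseFamilies_transfer`). As the Pixley–Roy space is countable,
one can split the sequence of families into infinitely many sequences and treat all `F` at once
(`SOne.denseFamilies_of_forall`, `SFin.denseFamilies_of_forall`).

*From density to networks.* Let `x ∈ Xᵏ` and `F = {x₁, …, xₖ}`. To a finite `N ⊆ Xᵏ` corresponds the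
open set of those `G` that either contain `F` and all coordinates of points of `N`, or miss the
closure of some `{xᵢ}` (`PixleyRoy.netOpen`). A neighbourhood `[F, W]` meets it exactly when
`N ⊆ Wᵏ`, so a `π`-network at `x` yields a dense open family. The condition `N ⊆ Wᵏ` does not
remember which coordinate lies where; this is repaired by using only those `N` contained in a fixed
box `∏ Uᵢ` in which coordinates of distinguishable `xᵢ`, `xⱼ` are kept apart, which exists when `X`
is `R₁` (`exists_separating_box`, `openDenseFamilies_transfer`).
-/

namespace DenseSelection

open Set

/-! ### Selection principles -/

section Selection

variable {α β : Type*} {𝒜 ℬ : Set (Set α)} {𝒜' ℬ' : Set (Set β)}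

theorem SOne.mono {𝒜₁ ℬ₁ : Set (Set α)} (h : SOne 𝒜 ℬ) (hA : 𝒜₁ ⊆ 𝒜) (hB : ℬ ⊆ ℬ₁) :
    SOne 𝒜₁ ℬ₁ := fun 𝒰 h𝒰 ↦
  let ⟨V, hV, hr⟩ := h 𝒰 fun n ↦ hA (h𝒰 n)
  ⟨V, hV, hB hr⟩

theorem SFin.mono {𝒜₁ ℬ₁ : Set (Set α)} (h : SFin 𝒜 ℬ) (hA : 𝒜₁ ⊆ 𝒜) (hB : ℬ ⊆ ℬ₁) :
    SFin 𝒜₁ ℬ₁ := fun 𝒰 h𝒰 ↦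
  let ⟨ℱ, hℱ, hr⟩ := h 𝒰 fun n ↦ hA (h𝒰 n)
  ⟨ℱ, hℱ, hB hr⟩

theorem SOne.sFin (h : SOne 𝒜 ℬ) : SFin 𝒜 ℬ := by
  intro 𝒰 h𝒰
  obtain ⟨V, hV, hr⟩ := h 𝒰 h𝒰
  refine ⟨fun n ↦ {V n}, fun n ↦ ⟨singleton_subset_iff.2 (hV n), finite_singleton _⟩, ?_⟩
  rwa [iUnion_singleton_eq_range]

/-- A relation `r` along which a selection principle for `(𝒜, ℬ)` can be carried over to
`(𝒜', ℬ')`: the elements related to some member of a family in `𝒜'` form a family in `𝒜`, and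
replacing each element of a family in `ℬ` by a related one gives a family in `ℬ'`. -/
structure SelectionTransfer (r : α → β → Prop) (𝒜 ℬ : Set (Set α)) (𝒜' ℬ' : Set (Set β)) :
    Prop where
  pull : ∀ 𝒰 ∈ 𝒜', {a | ∃ b ∈ 𝒰, r a b} ∈ 𝒜
  push : ∀ S ∈ ℬ, ∀ T : Set β, (∀ b ∈ T, ∃ 𝒰 ∈ 𝒜', b ∈ 𝒰) → (∀ a ∈ S, ∃ b ∈ T, r a b) → T ∈ ℬ'

theorem SelectionTransfer.sOne {r : α → β → Prop} (t : SelectionTransfer r 𝒜 ℬ 𝒜' ℬ')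
    (h : SOne 𝒜 ℬ) : SOne 𝒜' ℬ' := by
  intro 𝒰 h𝒰
  obtain ⟨V, hV, hr⟩ := h _ fun n ↦ t.pull _ (h𝒰 n)
  choose W hW hVW using hV
  refine ⟨W, hW, t.push _ hr _ ?_ ?_⟩
  · rintro _ ⟨n, rfl⟩
    exact ⟨_, h𝒰 n, hW n⟩
  · rintro _ ⟨n, rfl⟩
    exact ⟨_, mem_range_self n, hVW n⟩

theorem SelectionTransfer.sFin {r : α → β → Prop} (t : SelectionTransfer r 𝒜 ℬ 𝒜' ℬ')
    (h : SFin 𝒜 ℬ) : SFin 𝒜' ℬ' := by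
  intro 𝒰 h𝒰
  obtain ⟨ℱ, hℱ, hr⟩ := h _ fun n ↦ t.pull _ (h𝒰 n)
  choose W hW hVW using fun n (a : ℱ n) ↦ (hℱ n).1 a.2
  refine ⟨fun n ↦ range (W n), fun n ↦ ⟨range_subset_iff.2 (hW n), ?_⟩, t.push _ hr _ ?_ ?_⟩
  · have := (hℱ n).2.to_subtype
    exact finite_range _
  · intro b hb
    obtain ⟨n, a, rfl⟩ := mem_iUnion.1 hb
    exact ⟨_, h𝒰 n, hW n a⟩
  · intro a ha
    obtain ⟨n, hn⟩ := mem_iUnion.1 ha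
    exact ⟨_, mem_iUnion.2 ⟨n, mem_range_self ⟨a, hn⟩⟩, hVW n ⟨a, hn⟩⟩

end Selection

/-! ### Dense families and open covers of countable spaces -/

section Countable

variable {Y : Type*} [TopologicalSpace Y]

theorem openDenseFamilies_subset : OpenDenseFamilies Y ⊆ DenseFamilies Y := fun _ h ↦ h.1

theorem openCovers_subset_denseFamilies : OpenCovers Y ⊆ DenseFamilies Y := fun 𝒰 h ↦ by
  change Dense (⋃₀ 𝒰)
  rw [h.1]
  exact dense_univ

theorem sOne_openCovers [Countable Y] [Nonempty Y] : SOne (OpenCovers Y) (OpenCovers Y) := by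
  intro 𝒰 h𝒰
  obtain ⟨e, he⟩ := exists_surjective_nat Y
  have key : ∀ n, ∃ U ∈ 𝒰 n, e n ∈ U := fun n ↦ mem_sUnion.1 ((h𝒰 n).1 ▸ mem_univ (e n))
  choose V hV heV using key
  refine ⟨V, hV, eq_univ_of_forall fun y ↦ ?_, ?_⟩
  · obtain ⟨n, rfl⟩ := he y
    exact ⟨V n, mem_range_self n, heV n⟩
  · rintro _ ⟨n, rfl⟩
    exact (h𝒰 n).2 _ (hV n)

/-- The families of subsets of `Y` whose union has `y` in its closure. -/
def AdherentFamilies (y : Y) : Set (Set (Set Y)) := {𝒰 | y ∈ closure (⋃₀ 𝒰)}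

/-- The pairing function splits the sequence of dense families into one subsequence for each point
of the countable space. -/
theorem SOne.denseFamilies_of_forall [Countable Y] [Nonempty Y]
    (h : ∀ y : Y, SOne (DenseFamilies Y) (AdherentFamilies y)) :
    SOne (DenseFamilies Y) (DenseFamilies Y) := by
  intro 𝒰 h𝒰
  obtain ⟨e, he⟩ := exists_surjective_nat Y
  choose V hV hr using fun j ↦ h (e j) (fun n ↦ 𝒰 (Nat.pair j n)) fun n ↦ h𝒰 _
  refine ⟨fun m ↦ V m.unpair.1 m.unpair.2, fun m ↦ ?_, fun y ↦ ?_⟩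
  · simpa using hV m.unpair.1 m.unpair.2
  · obtain ⟨j, rfl⟩ := he y
    refine closure_mono (sUnion_mono ?_) (hr j)
    rintro _ ⟨n, rfl⟩
    exact ⟨Nat.pair j n, by simp⟩

theorem SFin.denseFamilies_of_forall [Countable Y] [Nonempty Y]
    (h : ∀ y : Y, SFin (DenseFamilies Y) (AdherentFamilies y)) :
    SFin (DenseFamilies Y) (DenseFamilies Y) := by
  intro 𝒰 h𝒰
  obtain ⟨e, he⟩ := exists_surjective_nat Y
  choose ℱ hℱ hr using fun j ↦ h (e j) (fun n ↦ 𝒰 (Nat.pair j n)) fun n ↦ h𝒰 _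
  refine ⟨fun m ↦ ℱ m.unpair.1 m.unpair.2, fun m ↦ ?_, fun y ↦ ?_⟩
  · simpa using hℱ m.unpair.1 m.unpair.2
  · obtain ⟨j, rfl⟩ := he y
    refine closure_mono (sUnion_mono (iUnion_subset fun n ↦ ?_)) (hr j)
    exact subset_iUnion_of_subset (Nat.pair j n) (by simp)

end Countable

/-! ### The Pixley–Roy topology -/

section PixleyRoy

variable {X : Type*}

instance [Countable X] : Countable (PixleyRoy X) :=
  inferInstanceAs (Countable {F : Finset X // F.Nonempty})

instance [Nonempty X] : Nonempty (PixleyRoy X) :=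
  ⟨⟨{Classical.arbitrary X}, Finset.singleton_nonempty _⟩⟩

variable [TopologicalSpace X]

theorem PixleyRoy.isOpen_basic (F : PixleyRoy X) {U : Set X} (hU : IsOpen U) :
    IsOpen (PixleyRoy.basic F U) :=
  TopologicalSpace.isOpen_generateFrom_of_mem ⟨F, U, hU, rfl⟩

theorem PixleyRoy.exists_basic_subset {O : Set (PixleyRoy X)} (hO : IsOpen O) {F : PixleyRoy X}
    (hF : F ∈ O) : ∃ U : Set X, IsOpen U ∧ (F.1 : Set X) ⊆ U ∧ PixleyRoy.basic F U ⊆ O := by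
  induction hO with
  | basic s hs =>
    obtain ⟨G, U, hU, rfl⟩ := hs
    exact ⟨U, hU, hF.2, fun H hH ↦ ⟨hF.1.trans hH.1, hH.2⟩⟩
  | univ => exact ⟨univ, isOpen_univ, subset_univ _, subset_univ _⟩
  | inter s t _ _ hs ht =>
    obtain ⟨U, hU, hFU, hUs⟩ := hs hF.1
    obtain ⟨V, hV, hFV, hVt⟩ := ht hF.2
    exact ⟨U ∩ V, hU.inter hV, subset_inter hFU hFV, fun H hH ↦
      ⟨hUs ⟨hH.1, hH.2.trans inter_subset_left⟩, hVt ⟨hH.1, hH.2.trans inter_subset_right⟩⟩⟩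
  | sUnion S _ ih =>
    obtain ⟨s, hs, hFs⟩ := hF
    obtain ⟨U, hU, hFU, hUs⟩ := ih s hs hFs
    exact ⟨U, hU, hFU, hUs.trans (subset_sUnion_of_mem hs)⟩

theorem PixleyRoy.mem_closure_iff {S : Set (PixleyRoy X)} {F : PixleyRoy X} :
    F ∈ closure S ↔ ∀ U : Set X, IsOpen U → (F.1 : Set X) ⊆ U →
      ∃ H ∈ S, F.1 ⊆ H.1 ∧ (H.1 : Set X) ⊆ U := by
  rw [_root_.mem_closure_iff]
  constructor
  · intro h U hU hFU
    obtain ⟨H, hH, hHS⟩ := h _ (PixleyRoy.isOpen_basic F hU) ⟨subset_rfl, hFU⟩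
    exact ⟨H, hHS, hH⟩
  · intro h O hO hF
    obtain ⟨U, hU, hFU, hUO⟩ := PixleyRoy.exists_basic_subset hO hF
    obtain ⟨H, hHS, hH⟩ := h U hU hFU
    exact ⟨H, hUO hH, hHS⟩

end PixleyRoy

/-! ### From networks in powers to dense families -/

section Forward

variable {X : Type*} {k : ℕ}

/-- The finite box `N = ∏ Hᵢ` around `x` is related to `U` if the set `⋃ Hᵢ` is a point of `U`. -/
def BoxRel (x : Fin k → X) (N : Set (Fin k → X)) (U : Set (PixleyRoy X)) : Prop :=
  ∃ Hs : Fin k → Finset X, (∀ i, x i ∈ Hs i) ∧ N = {f | ∀ i, f i ∈ Hs i} ∧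
    ∃ H ∈ U, ∀ y, y ∈ H.1 ↔ ∃ i, y ∈ Hs i

theorem denseFamilies_transfer [TopologicalSpace X] (F : PixleyRoy X) (x : Fin k → X)
    (hx : ∀ y, y ∈ F.1 ↔ ∃ i, x i = y) :
    SelectionTransfer (BoxRel x) (PiNetFin x) (PiNetFin x)
      (DenseFamilies (PixleyRoy X)) (AdherentFamilies F) where
  pull 𝒰 h𝒰 := by
    classical
    refine ⟨?_, fun O hO hxO ↦ ?_⟩
    · rintro _ ⟨_, _, Hs, -, rfl, -⟩
      refine (Fintype.piFinset Hs).finite_toSet.subset fun f hf ↦ ?_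
      simpa using hf
    · obtain ⟨U, hU, hUO⟩ := isOpen_pi_iff'.1 hO x hxO
      have hFU : (F.1 : Set X) ⊆ ⋃ i, U i := by
        intro y hy
        obtain ⟨i, rfl⟩ := (hx y).1 hy
        exact mem_iUnion.2 ⟨i, (hU i).2⟩
      obtain ⟨H, ⟨V, hV, hHV⟩, hFH, hHU⟩ :=
        PixleyRoy.mem_closure_iff.1 (h𝒰 F) _ (isOpen_iUnion fun i ↦ (hU i).1) hFU
      refine ⟨_, ⟨V, hV, fun i ↦ H.1.filter (· ∈ U i), fun i ↦ ?_, rfl, H, hHV, fun y ↦ ?_⟩, ?_⟩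
      · exact Finset.mem_filter.2 ⟨hFH ((hx _).2 ⟨i, rfl⟩), (hU i).2⟩
      · simp only [Finset.mem_filter, exists_and_left, iff_self_and]
        exact fun hy ↦ mem_iUnion.1 (hHU hy)
      · exact fun f hf ↦ hUO fun i _ ↦ (Finset.mem_filter.1 (hf i)).2
  push S hS T _ hST := by
    refine PixleyRoy.mem_closure_iff.2 fun U hU hFU ↦ ?_
    have hxU : ∀ i, x i ∈ U := fun i ↦ hFU ((hx _).2 ⟨i, rfl⟩)
    obtain ⟨N, hN, hNU⟩ := hS.2 (univ.pi fun _ ↦ U)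
      (isOpen_set_pi finite_univ fun _ _ ↦ hU) fun i _ ↦ hxU i
    obtain ⟨V, hV, Hs, hxH, rfl, H, hHV, hH⟩ := hST N hN
    refine ⟨H, ⟨V, hV, hHV⟩, fun y hy ↦ ?_, fun y hy ↦ ?_⟩
    · obtain ⟨i, rfl⟩ := (hx y).1 hy
      exact (hH _).2 ⟨i, hxH i⟩
    · obtain ⟨i, hi⟩ := (hH y).1 hy
      -- the other factors of the box are nonempty, so `y` is a coordinate of a point of the box
      have hmem : Function.update x i y ∈ {f : Fin k → X | ∀ j, f j ∈ Hs j} := by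
        intro j
        rcases eq_or_ne j i with rfl | hj
        · simpa using hi
        · simpa [hj] using hxH j
      simpa using hNU hmem i (mem_univ i)

theorem PixleyRoy.exists_enum (F : PixleyRoy X) :
    ∃ (k : ℕ) (x : Fin k → X), ∀ y, y ∈ F.1 ↔ ∃ i, x i = y :=
  ⟨_, fun i ↦ (F.1.equivFin.symm i : X), fun y ↦
    ⟨fun hy ↦ ⟨F.1.equivFin ⟨y, hy⟩, by simp⟩, by rintro ⟨i, rfl⟩; exact Subtype.prop _⟩⟩

variable [TopologicalSpace X] [Countable X] [Nonempty X]

theorem sOne_denseFamilies (h : ∀ k : ℕ, SOnePiNetFin (Fin k → X)) :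
    SOne (DenseFamilies (PixleyRoy X)) (DenseFamilies (PixleyRoy X)) :=
  SOne.denseFamilies_of_forall fun F ↦
    let ⟨k, x, hx⟩ := F.exists_enum
    (denseFamilies_transfer F x hx).sOne (h k x)

theorem sFin_denseFamilies (h : ∀ k : ℕ, SFinPiNetFin (Fin k → X)) :
    SFin (DenseFamilies (PixleyRoy X)) (DenseFamilies (PixleyRoy X)) :=
  SFin.denseFamilies_of_forall fun F ↦
    let ⟨k, x, hx⟩ := F.exists_enum
    (denseFamilies_transfer F x hx).sFin (h k x)

end Forward

/-! ### From dense open families to networks in powers -/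

section Backward

variable {X : Type*} [TopologicalSpace X] {k : ℕ}

/-- The set of those points `G` of the Pixley–Roy space that contain all coordinates of `x` and of
the points of `N`, or that miss the closure of some coordinate of `x`. -/
def PixleyRoy.netOpen (x : Fin k → X) (N : Set (Fin k → X)) : Set (PixleyRoy X) :=
  {G | (∀ i, x i ∈ G.1 ∧ ∀ f ∈ N, f i ∈ G.1) ∨ ∃ i, ∀ y ∈ G.1, y ∉ closure {x i}}

theorem PixleyRoy.isOpen_netOpen (x : Fin k → X) (N : Set (Fin k → X)) :
    IsOpen (PixleyRoy.netOpen x N) := by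
  refine isOpen_iff_forall_mem_open.2 fun G hG ↦ ?_
  rcases hG with hG | ⟨i, hG⟩
  · refine ⟨_, ?_, G.isOpen_basic isOpen_univ, subset_rfl, subset_univ _⟩
    exact fun H hH ↦ Or.inl fun i ↦ ⟨hH.1 (hG i).1, fun f hf ↦ hH.1 ((hG i).2 f hf)⟩
  · refine ⟨_, ?_, G.isOpen_basic (isClosed_closure (s := {x i})).isOpen_compl, subset_rfl, hG⟩
    exact fun H hH ↦ Or.inr ⟨i, hH.2⟩

/-- Around a point of a power of an `R₁` space there is an open box `∏ Uᵢ` which keeps the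
topologically distinguishable coordinates apart. -/
theorem exists_separating_box [R1Space X] (x : Fin k → X) :
    ∃ U : Fin k → Set X, (∀ i, IsOpen (U i) ∧ x i ∈ U i) ∧
      ∀ i j, ¬ Inseparable (x i) (x j) → Disjoint (U i) (U j) := by
  have key : ∀ i j, ∃ A B : Set X, IsOpen A ∧ IsOpen B ∧ x i ∈ A ∧ x j ∈ B ∧
      (¬ Inseparable (x i) (x j) → Disjoint A B) := by
    intro i j
    by_cases h : Inseparable (x i) (x j)
    · exact ⟨univ, univ, isOpen_univ, isOpen_univ, trivial, trivial, fun h' ↦ absurd h h'⟩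
    · have hd := (r1Space_iff_inseparable_or_disjoint_nhds.1 ‹_› (x i) (x j)).resolve_left h
      obtain ⟨A, ⟨hxA, hA⟩, B, ⟨hxB, hB⟩, hAB⟩ :=
        ((nhds_basis_opens (x i)).disjoint_iff (nhds_basis_opens (x j))).1 hd
      exact ⟨A, B, hA, hB, hxA, hxB, fun _ ↦ hAB⟩
  choose A B hA hB hxA hxB hAB using key
  refine ⟨fun i ↦ ⋂ j, A i j ∩ B j i, fun i ↦ ⟨?_, ?_⟩, fun i j hij ↦ ?_⟩
  · exact isOpen_iInter_of_finite fun j ↦ (hA i j).inter (hB j i)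
  · exact mem_iInter.2 fun j ↦ ⟨hxA i j, hxB j i⟩
  · exact (hAB i j hij).mono ((iInter_subset _ j).trans inter_subset_left)
      ((iInter_subset _ i).trans inter_subset_right)

theorem openDenseFamilies_transfer [R1Space X] [NeZero k] (x : Fin k → X) {U : Fin k → Set X}
    (hU : ∀ i, IsOpen (U i) ∧ x i ∈ U i)
    (hd : ∀ i j, ¬ Inseparable (x i) (x j) → Disjoint (U i) (U j)) :
    SelectionTransfer
      (fun (V : Set (PixleyRoy X)) (N : Set (Fin k → X)) ↦
        N ⊆ univ.pi U ∧ V = PixleyRoy.netOpen x N)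
      (OpenDenseFamilies (PixleyRoy X)) (DenseFamilies (PixleyRoy X))
      (PiNetFin x) (PiNetFin x) where
  pull 𝒩 h𝒩 := by
    classical
    refine ⟨fun G ↦ PixleyRoy.mem_closure_iff.2 fun W hW hGW ↦ ?_, ?_⟩
    · have hbox : IsOpen (univ.pi U) := isOpen_set_pi finite_univ fun i _ ↦ (hU i).1
      by_cases hG : ∃ i, ∀ y ∈ G.1, y ∉ closure {x i}
      · obtain ⟨N, hN, hNU⟩ := h𝒩.2 _ hbox fun i _ ↦ (hU i).2
        exact ⟨G, ⟨_, ⟨N, hN, hNU, rfl⟩, Or.inr hG⟩, subset_rfl, hGW⟩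
      · push Not at hG
        have hxW : ∀ i, x i ∈ W := fun i ↦ by
          obtain ⟨y, hy, hyx⟩ := hG i
          obtain ⟨_, hz, rfl⟩ := _root_.mem_closure_iff.1 hyx W hW (hGW hy)
          exact hz
        obtain ⟨N, hN, hNU⟩ := h𝒩.2 (univ.pi U ∩ univ.pi fun _ ↦ W)
          (hbox.inter (isOpen_set_pi finite_univ fun _ _ ↦ hW))
          ⟨fun i _ ↦ (hU i).2, fun i _ ↦ hxW i⟩
        have hcoord : (⋃ i, ((fun f : Fin k → X ↦ f i) '' N)).Finite :=
          finite_iUnion fun i ↦ (h𝒩.1 N hN).image _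
        refine ⟨⟨G.1 ∪ (Finset.univ.image x ∪ hcoord.toFinset), G.2.inl⟩,
          ⟨_, ⟨N, hN, hNU.trans inter_subset_left, rfl⟩, Or.inl fun i ↦ ⟨?_, fun f hf ↦ ?_⟩⟩,
          Finset.subset_union_left, ?_⟩
        · simp
        · refine Finset.mem_union_right _ (Finset.mem_union_right _ ?_)
          exact hcoord.mem_toFinset.2 (mem_iUnion.2 ⟨i, f, hf, rfl⟩)
        · intro y hy
          rcases Finset.mem_union.1 hy with hy | hy
          · exact hGW hy
          rcases Finset.mem_union.1 hy with hy | hy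
          · obtain ⟨i, -, rfl⟩ := Finset.mem_image.1 hy
            exact hxW i
          · obtain ⟨i, f, hf, rfl⟩ := mem_iUnion.1 (hcoord.mem_toFinset.1 hy)
            exact (hNU hf).2 i (mem_univ i)
    · rintro _ ⟨N, -, -, rfl⟩
      exact PixleyRoy.isOpen_netOpen x N
  push S hS T hT hST := by
    classical
    refine ⟨fun N hN ↦ ?_, fun O hO hxO ↦ ?_⟩
    · obtain ⟨𝒰, h𝒰, hN𝒰⟩ := hT N hN
      exact h𝒰.1 N hN𝒰
    obtain ⟨V, hV, hVO⟩ := isOpen_pi_iff'.1 hO x hxO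
    -- `W i` shrinks `U i` into `V j` for every coordinate `x j` indistinguishable from `x i`
    let W : Fin k → Set X := fun i ↦ U i ∩ ⋂ j, ⋂ _ : Inseparable (x i) (x j), V j
    have hW : ∀ i, IsOpen (W i) := fun i ↦ (hU i).1.inter
      (isOpen_iInter_of_finite fun j ↦ isOpen_iInter_of_finite fun _ ↦ (hV j).1)
    have hxW : ∀ i, x i ∈ W i := fun i ↦ ⟨(hU i).2, mem_iInter₂.2 fun j hij ↦
      (hij.mem_open_iff (hV j).1).2 (hV j).2⟩
    let F : PixleyRoy X := ⟨Finset.univ.image x, Finset.univ_nonempty.image x⟩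
    have hxF : ∀ i, x i ∈ F.1 := fun i ↦ Finset.mem_image_of_mem x (Finset.mem_univ i)
    obtain ⟨H, ⟨A, hA, hHA⟩, hFH, hHW⟩ := PixleyRoy.mem_closure_iff.1 (hS F) (⋃ i, W i)
      (isOpen_iUnion hW) fun y hy ↦ by
        obtain ⟨i, -, rfl⟩ := Finset.mem_image.1 hy
        exact mem_iUnion.2 ⟨i, hxW i⟩
    obtain ⟨N, hN, hNU, rfl⟩ := hST A hA
    have hH : ∀ i, x i ∈ H.1 ∧ ∀ f ∈ N, f i ∈ H.1 :=
      hHA.resolve_right fun ⟨i, hi⟩ ↦ hi _ (hFH (hxF i)) (subset_closure rfl)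
    refine ⟨N, hN, fun f hf ↦ hVO fun i _ ↦ ?_⟩
    obtain ⟨j, hj⟩ := mem_iUnion.1 (hHW ((hH i).2 f hf))
    by_cases hji : Inseparable (x j) (x i)
    · exact mem_iInter₂.1 hj.2 i hji
    · exact absurd (hNU hf i (mem_univ i)) (disjoint_left.1 (hd j i hji) hj.1)

theorem sOnePiNetFin_of_subsingleton [Subsingleton X] : SOnePiNetFin X := by
  intro x 𝒩 h𝒩
  choose A hA _ using fun n ↦ (h𝒩 n).2 univ isOpen_univ (mem_univ x)
  refine ⟨A, hA, ?_, fun U _ hx ↦ ⟨A 0, mem_range_self 0, fun y _ ↦ Subsingleton.elim x y ▸ hx⟩⟩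
  rintro _ ⟨n, rfl⟩
  exact (h𝒩 n).1 _ (hA n)

theorem sOnePiNetFin_of_sOne [R1Space X]
    (h : SOne (OpenDenseFamilies (PixleyRoy X)) (DenseFamilies (PixleyRoy X))) (k : ℕ) :
    SOnePiNetFin (Fin k → X) := by
  -- the empty power does not give a point of the Pixley–Roy space
  rcases k.eq_zero_or_pos with rfl | hk
  · exact sOnePiNetFin_of_subsingleton
  · have : NeZero k := ⟨hk.ne'⟩
    intro x
    obtain ⟨U, hU, hd⟩ := exists_separating_box x
    exact (openDenseFamilies_transfer x hU hd).sOne h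

theorem sFinPiNetFin_of_sFin [R1Space X]
    (h : SFin (OpenDenseFamilies (PixleyRoy X)) (DenseFamilies (PixleyRoy X))) (k : ℕ) :
    SFinPiNetFin (Fin k → X) := by
  intro x
  rcases k.eq_zero_or_pos with rfl | hk
  · exact (sOnePiNetFin_of_subsingleton x).sFin
  · have : NeZero k := ⟨hk.ne'⟩
    obtain ⟨U, hU, hd⟩ := exists_separating_box x
    exact (openDenseFamilies_transfer x hU hd).sFin h

end Backward

end DenseSelection

theorem mainTheorem12 {X : Type*} [TopologicalSpace X] [Countable X] [Nonempty X] :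
    -- (1)
    ((∀ k : ℕ, SOnePiNetFin (Fin k → X)) →
      SFin (DenseFamilies (PixleyRoy X)) (DenseFamilies (PixleyRoy X)) ∧
      SFin (OpenDenseFamilies (PixleyRoy X)) (DenseFamilies (PixleyRoy X)) ∧
      SFin (OpenCovers (PixleyRoy X)) (DenseFamilies (PixleyRoy X)) ∧
      SFin (OpenCovers (PixleyRoy X)) (OpenCovers (PixleyRoy X)) ∧
      SOne (DenseFamilies (PixleyRoy X)) (DenseFamilies (PixleyRoy X)) ∧
      SOne (OpenDenseFamilies (PixleyRoy X)) (DenseFamilies (PixleyRoy X)) ∧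
      SOne (OpenCovers (PixleyRoy X)) (DenseFamilies (PixleyRoy X)) ∧
      SOne (OpenCovers (PixleyRoy X)) (OpenCovers (PixleyRoy X))) ∧
    -- (2)
    ((∃ k : ℕ, ¬ SOnePiNetFin (Fin k → X)) → (∀ k : ℕ, SFinPiNetFin (Fin k → X)) →
      SFin (DenseFamilies (PixleyRoy X)) (DenseFamilies (PixleyRoy X)) ∧
      SFin (OpenDenseFamilies (PixleyRoy X)) (DenseFamilies (PixleyRoy X)) ∧
      SFin (OpenCovers (PixleyRoy X)) (DenseFamilies (PixleyRoy X)) ∧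
      SFin (OpenCovers (PixleyRoy X)) (OpenCovers (PixleyRoy X)) ∧
      (R1Space X →
        ¬ SOne (DenseFamilies (PixleyRoy X)) (DenseFamilies (PixleyRoy X)) ∧
        ¬ SOne (OpenDenseFamilies (PixleyRoy X)) (DenseFamilies (PixleyRoy X))) ∧
      SOne (OpenCovers (PixleyRoy X)) (DenseFamilies (PixleyRoy X)) ∧
      SOne (OpenCovers (PixleyRoy X)) (OpenCovers (PixleyRoy X))) ∧
    -- (3)
    ((∃ k : ℕ, ¬ SFinPiNetFin (Fin k → X)) →
      (R1Space X →
        ¬ SFin (DenseFamilies (PixleyRoy X)) (DenseFamilies (PixleyRoy X)) ∧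
        ¬ SFin (OpenDenseFamilies (PixleyRoy X)) (DenseFamilies (PixleyRoy X))) ∧
      SFin (OpenCovers (PixleyRoy X)) (DenseFamilies (PixleyRoy X)) ∧
      SFin (OpenCovers (PixleyRoy X)) (OpenCovers (PixleyRoy X)) ∧
      (R1Space X →
        ¬ SOne (DenseFamilies (PixleyRoy X)) (DenseFamilies (PixleyRoy X)) ∧
        ¬ SOne (OpenDenseFamilies (PixleyRoy X)) (DenseFamilies (PixleyRoy X))) ∧
      SOne (OpenCovers (PixleyRoy X)) (DenseFamilies (PixleyRoy X)) ∧
      SOne (OpenCovers (PixleyRoy X)) (OpenCovers (PixleyRoy X))) := by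
  have hOO : SOne (OpenCovers (PixleyRoy X)) (OpenCovers (PixleyRoy X)) := sOne_openCovers
  have hOD : SOne (OpenCovers (PixleyRoy X)) (DenseFamilies (PixleyRoy X)) :=
    hOO.mono subset_rfl openCovers_subset_denseFamilies
  have hsub : OpenDenseFamilies (PixleyRoy X) ⊆ DenseFamilies (PixleyRoy X) :=
    openDenseFamilies_subset
  refine ⟨fun h ↦ ?_, fun ⟨k, hk⟩ h ↦ ?_, fun ⟨k, hk⟩ ↦ ?_⟩
  · have hDD := sOne_denseFamilies h
    have hDoD := hDD.mono hsub subset_rfl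
    exact ⟨hDD.sFin, hDoD.sFin, hOD.sFin, hOO.sFin, hDD, hDoD, hOD, hOO⟩
  · have hDD := sFin_denseFamilies h
    refine ⟨hDD, hDD.mono hsub subset_rfl, hOD.sFin, hOO.sFin, fun _ ↦ ?_, hOD, hOO⟩
    have hno : ¬ SOne (OpenDenseFamilies (PixleyRoy X)) (DenseFamilies (PixleyRoy X)) :=
      fun h' ↦ hk (sOnePiNetFin_of_sOne h' k)
    exact ⟨fun h' ↦ hno (h'.mono hsub subset_rfl), hno⟩
  · have hno : R1Space X →
        ¬ SFin (OpenDenseFamilies (PixleyRoy X)) (DenseFamilies (PixleyRoy X)) :=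
      fun _ h' ↦ hk (sFinPiNetFin_of_sFin h' k)
    exact ⟨fun hX ↦ ⟨fun h' ↦ hno hX (h'.mono hsub subset_rfl), hno hX⟩, hOD.sFin, hOO.sFin,
      fun hX ↦ ⟨fun h' ↦ hno hX (h'.mono hsub subset_rfl).sFin, fun h' ↦ hno hX h'.sFin⟩, hOD, hOO⟩
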